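/- Let $(z,w_2,w_3,w_4)$ be the coordinates of $\mathbb C^4$. For $(a,b,c)\in\mathbb R^3\setminus\{0\}$ let $Q_{a,b,c}\subset\mathbb C^4$ be the model surface $$\operatorname{Im} w_2=|z|^2,\qquad \operatorname{Im} w_3=2\operatorname{Re}(z^2\bar z),\qquad \operatorname{Im} w_4=a|z|^4+2b\operatorname{Re}(z^3\bar z)-2c\operatorname{Im}(z^3\bar z),$$ and let $\mathcal C=\{x_2=x_1^2,\ x_3=x_1^3,\ x_4=x_1^4\}\subset\mathbb C^4$ (coordinates $x_j+iy_j$, with $y_1,\dots,y_4\in\mathbb R$ arbitrary) be the tube over the curve $\{(s,s^2,s^3,s^4):s\in\mathbb R\}\subset\mathbb R^4$. Call $M\subset\mathbb C^4$ locally holomorphically homogeneous if for all $p,q\in M$ there is a biholomorphism $U\to V$ from an open neighbourhood of $p$ onto an open neighbourhood of $q$ that takes $p$ to $q$ and $U\cap M$ onto $V\cap M$, and globally holomorphically homogeneous if for all $p,q\in M$ there is a biholomorphism between open neighbourhoods of $M$ that maps $M$ onto $M$ and $p$ to $q$. Then: 1. If $Q_{a,b,c}$ is locally holomorphically homogeneous,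 then $(a:b:c)=(3:2:0)$, that is, $(a,b,c)=t\,(3,2,0)$ for some real $t\neq0$, and $Q_{a,b,c}$ is biholomorphic to $\mathcal C$ (some biholomorphism from an open neighbourhood of $Q_{a,b,c}$ onto an open neighbourhood of $\mathcal C$ maps $Q_{a,b,c}$ onto $\mathcal C$). Conversely, if $(a:b:c)=(3:2:0)$, then $Q_{a,b,c}$ is globally holomorphically homogeneous. 2. For every real $t\ne0$ the triangular polynomial map $$(z,w_2,w_3,w_4)\mapsto\Bigl(2z,\ -2i\,w_2+2z^2,\ -3i\,w_3+2z^3,\ -\tfrac{2i}{t}\,w_4+2z^4\Bigr)$$ is a biholomorphism of $\mathbb C^4$ onto itself that maps $Q_{3t,2t,0}$ onto $\mathcal C$. 3. The curve $\{(s,s^2,s^3,s^4):s\in\mathbb R\}$ is affinely homogeneous: the affine automorphisms of $\mathbb R^4$ that preserve it act transitively on it. -/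

import Mathlib

open scoped ComplexConjugate

/-- The ambient space `ℂ⁴`. For the model surfaces its coordinates are
`(z, w₂, w₃, w₄) = (p 0, p 1, p 2, p 3)`. -/
abbrev C4 : Type := Fin 4 → ℂ

/-- The real surface `Q_{a,b,c}` in `ℂ⁴`:
`Im w₂ = |z|²`, `Im w₃ = 2 Re (z² z̄)`,
`Im w₄ = a |z|⁴ + 2 b Re (z³ z̄) - 2 c Im (z³ z̄)`. -/
def modelSurface (a b c : ℝ) : Set C4 :=
  {p | (p 1).im = ‖p 0‖ ^ 2 ∧
       (p 2).im = 2 * ((p 0) ^ 2 * conj (p 0)).re ∧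
       (p 3).im = a * ‖p 0‖ ^ 4 + 2 * b * ((p 0) ^ 3 * conj (p 0)).re
          - 2 * c * ((p 0) ^ 3 * conj (p 0)).im}

/-- The curve `x₂ = x₁²`, `x₃ = x₁³`, `x₄ = x₁⁴` in `ℝ⁴`. -/
def momentCurve : Set (Fin 4 → ℝ) :=
  {x | x 1 = x 0 ^ 2 ∧ x 2 = x 0 ^ 3 ∧ x 3 = x 0 ^ 4}

/-- The tube `S + i ℝ⁴` over a subset `S` of `ℝ⁴`. -/
def tube (S : Set (Fin 4 → ℝ)) : Set C4 :=
  {p | (fun i => (p i).re) ∈ S}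

/-- The tubular surface `𝒞`: `x₂ = x₁²`, `x₃ = x₁³`, `x₄ = x₁⁴`, with `y₁, …, y₄` arbitrary. -/
def tubeC : Set C4 := tube momentCurve

/-- A subset of `ℝ⁴` is affinely homogeneous if the affine automorphisms of `ℝ⁴` that preserve it
act transitively on it. -/
def IsAffinelyHomogeneous (S : Set (Fin 4 → ℝ)) : Prop :=
  ∀ x ∈ S, ∀ y ∈ S, ∃ A : (Fin 4 → ℝ) ≃ᵃ[ℝ] (Fin 4 → ℝ), A '' S = S ∧ A x = y

/-- A homeomorphism `e` between two open subsets `e.source`, `e.target` of `ℂ⁴` is a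
biholomorphism if it and its inverse are holomorphic. -/
def IsBiholomorphism (e : OpenPartialHomeomorph C4 C4) : Prop :=
  DifferentiableOn ℂ e e.source ∧ DifferentiableOn ℂ e.symm e.target

/-- Two subsets `M`, `N` of `ℂ⁴` are biholomorphic if some biholomorphism between an open
neighbourhood of `M` and an open neighbourhood of `N` maps `M` onto `N`. -/
def AreBiholomorphic (M N : Set C4) : Prop :=
  ∃ e : OpenPartialHomeomorph C4 C4,
    IsBiholomorphism e ∧ M ⊆ e.source ∧ N ⊆ e.target ∧ e '' M = N

/-- Local holomorphic homogeneity: the germs of `M` at any two of its points `p`, `q` are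
biholomorphically equivalent, that is, a biholomorphism `e : U → V` from a neighbourhood of `p`
to a neighbourhood of `q` takes `p` to `q` and `U ∩ M` onto `V ∩ M`. -/
def IsLocallyHolHomogeneous (M : Set C4) : Prop :=
  ∀ p ∈ M, ∀ q ∈ M, ∃ e : OpenPartialHomeomorph C4 C4,
    IsBiholomorphism e ∧ p ∈ e.source ∧ e '' (e.source ∩ M) = e.target ∩ M ∧ e p = q

/-- Global holomorphic homogeneity: the holomorphic automorphisms of `M` (biholomorphisms between
open neighbourhoods of `M` that map `M` onto `M`) act transitively on `M`. -/
def IsHolHomogeneous (M : Set C4) : Prop :=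
  ∀ p ∈ M, ∀ q ∈ M, ∃ e : OpenPartialHomeomorph C4 C4,
    IsBiholomorphism e ∧ M ⊆ e.source ∧ M ⊆ e.target ∧ e '' M = M ∧ e p = q

/-- The triangular polynomial map
`(z, w₂, w₃, w₄) ↦ (2 z, -2 i w₂ + 2 z², -3 i w₃ + 2 z³, -(2 i / t) w₄ + 2 z⁴)`. -/
noncomputable def triangularMap (t : ℝ) (p : C4) : C4 :=
  ![2 * p 0,
    -2 * Complex.I * p 1 + 2 * (p 0) ^ 2,
    -3 * Complex.I * p 2 + 2 * (p 0) ^ 3,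
    -(2 * Complex.I / (t : ℂ)) * p 3 + 2 * (p 0) ^ 4]

/-! Necessity. Let `s = 3cx + (3b - 2a)y`. Recentring `Q_{a,b,c}` at a point over `z = x + iy`
removes everything of degree at most three from the last equation except `-2s Im(z² z̄)`
(`exists_homeomorph_perturbedSurface`). At the origin of `Q_{a,b,c}` the function `w₄` is a
noncritical holomorphic germ whose imaginary part on the surface is `O(|z|⁴)`. On the perturbed
surface with `s ≠ 0` every such germ is critical (`fderiv_eq_zero_of_im_isBigO`): the two defining
functions of weight three are now the independent cubics `|z|² Re z` and `|z|² Im z`, and neither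
can be cancelled by the imaginary part of a holomorphic expression. Homogeneity therefore forces `s`
to vanish for all `x, y`, that is, `c = 0` and `3b = 2a`.

Sufficiency. Expanding `(z + z̄)ⁿ` for `n = 2, 3, 4` shows that `Q_{3t,2t,0}` is the tube `𝒞` in
triangular coordinates; the ratio `3 : 2` comes from the binomial coefficients `6` and `4`.
Parameter shifts of the curve, complexified, together with imaginary translations, act transitively
on `𝒞`. -/

section

open Filter Topology Asymptotics

/-! ### Directional derivatives of holomorphic functions are holomorphic -/

section HolomorphicDerivative

variable {E : Type*} [NormedAddCommGroup E] [NormedSpace ℂ E]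

/-- Cauchy's estimate on each complex line through `x`, on the disc of radius `r / ‖v‖` in direction
`v`. -/
theorem norm_fderiv_le_of_forall_mem_ball {f : E → ℂ} {x : E} {r C : ℝ} (hr : 0 < r)
    (hf : DifferentiableOn ℂ f (Metric.ball x (2 * r)))
    (hC : ∀ y ∈ Metric.ball x (2 * r), ‖f y‖ ≤ C) : ‖fderiv ℂ f x‖ ≤ C / r := by
  have hC0 : 0 ≤ C := (norm_nonneg _).trans (hC x (Metric.mem_ball_self (by positivity)))
  refine ContinuousLinearMap.opNorm_le_bound _ (by positivity) fun v => ?_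
  rcases eq_or_ne v 0 with rfl | hv
  · simp
  have hv' : 0 < ‖v‖ := norm_pos_iff.2 hv
  have hmem : ∀ τ ∈ Metric.closedBall (0 : ℂ) (r / ‖v‖), x + τ • v ∈ Metric.ball x (2 * r) := by
    intro τ hτ
    rw [mem_closedBall_zero_iff, le_div_iff₀ hv'] at hτ
    rw [mem_ball_iff_norm, add_sub_cancel_left, norm_smul]
    linarith
  have hline : ∀ τ : ℂ, HasDerivAt (fun τ : ℂ => x + τ • v) v τ := fun τ => by
    simpa using ((hasDerivAt_id τ).smul_const v).const_add x
  have hd : DifferentiableOn ℂ (fun τ : ℂ => f (x + τ • v))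
      (Metric.closedBall (0 : ℂ) (r / ‖v‖)) :=
    hf.comp (fun τ _ => (hline τ).differentiableAt.differentiableWithinAt) hmem
  have hdc : DiffContOnCl ℂ (fun τ : ℂ => f (x + τ • v)) (Metric.ball (0 : ℂ) (r / ‖v‖)) :=
    DifferentiableOn.diffContOnCl_ball hd subset_rfl
  have key := Complex.norm_deriv_le_of_forall_mem_sphere_norm_le (C := C) (by positivity) hdc
    (fun τ hτ => hC _ (hmem τ (Metric.sphere_subset_closedBall hτ)))
  have hx : HasFDerivAt f (fderiv ℂ f x) (x + (0 : ℂ) • v) := by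
    rw [zero_smul, add_zero]
    exact (hf.differentiableAt (Metric.ball_mem_nhds x (by positivity))).hasFDerivAt
  have : deriv (fun τ : ℂ => f (x + τ • v)) 0 = fderiv ℂ f x v :=
    (hx.comp_hasDerivAt (0 : ℂ) (hline 0)).deriv
  rw [this] at key
  calc _ ≤ _ := key
    _ = C / r * ‖v‖ := by field_simp

/-- Cauchy's formula on the line in direction `v` writes the derivative as a circle integral of
values of `f`, which can be differentiated in `x` under the integral sign. This allows the iterated
derivatives in the Taylor expansions below. -/
theorem differentiableOn_fderiv_apply [FiniteDimensional ℂ E] {f : E → ℂ}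
    {U : Set E} (hU : IsOpen U) (hf : DifferentiableOn ℂ f U) (v : E) :
    DifferentiableOn ℂ (fun x => fderiv ℂ f x v) U := by
  borelize E
  intro x₀ hx₀
  refine DifferentiableAt.differentiableWithinAt ?_
  obtain ⟨R, hR, hRU⟩ : ∃ R > 0, Metric.ball x₀ R ⊆ U ∩ {y | ‖f y‖ < ‖f x₀‖ + 1} := by
    refine Metric.mem_nhds_iff.1 (inter_mem (hU.mem_nhds hx₀) ?_)
    exact ((hf.differentiableAt (hU.mem_nhds hx₀)).continuousAt.norm).eventually_lt_const
      (lt_add_one _)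
  set C := ‖f x₀‖ + 1
  -- Three nested balls: `x` varies in radius `r`, the circles of integration stay in radius `2r`,
  -- and Cauchy's estimate on them uses radius `4r`, where `f` is bounded.
  obtain ⟨r, hr, rfl⟩ : ∃ r > 0, R = 4 * r := ⟨R / 4, by positivity, by ring⟩
  obtain ⟨ρ, hρ, hρv⟩ : ∃ ρ > 0, ρ * ‖v‖ ≤ r := by
    refine ⟨r / (‖v‖ + 1), by positivity, ?_⟩
    rw [div_mul_eq_mul_div, div_le_iff₀ (by positivity)]
    nlinarith [norm_nonneg v]
  have hmem : ∀ x ∈ Metric.ball x₀ r, ∀ τ ∈ Metric.closedBall (0 : ℂ) ρ,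
      x + τ • v ∈ Metric.ball x₀ (2 * r) := by
    intro x hx τ hτ
    rw [mem_closedBall_zero_iff] at hτ
    rw [mem_ball_iff_norm] at hx ⊢
    calc ‖x + τ • v - x₀‖ = ‖(x - x₀) + τ • v‖ := by congr 1; abel
      _ ≤ ‖x - x₀‖ + ‖τ‖ * ‖v‖ := by rw [← norm_smul]; exact norm_add_le _ _
      _ < 2 * r := by nlinarith [norm_nonneg v]
  have hdiff : ∀ y ∈ Metric.ball x₀ (2 * r), DifferentiableAt ℂ f y := fun y hy =>
    hf.differentiableAt (hU.mem_nhds (hRU (Metric.ball_subset_ball (by linarith) hy)).1)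
  have hbound : ∀ y ∈ Metric.ball x₀ (2 * r), ‖fderiv ℂ f y‖ ≤ C / r := by
    intro y hy
    have hsub : Metric.ball y (2 * r) ⊆ Metric.ball x₀ (4 * r) :=
      Metric.ball_subset_ball' (by rw [Metric.mem_ball] at hy; linarith)
    exact norm_fderiv_le_of_forall_mem_ball hr (hf.mono fun z hz => (hRU (hsub hz)).1)
      (fun z hz => (hRU (hsub hz)).2.le)
  have hline : ∀ (x : E) (τ : ℂ), HasDerivAt (fun τ : ℂ => x + τ • v) v τ := fun x τ => by
    simpa using ((hasDerivAt_id τ).smul_const v).const_add x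
  have hcirc : ∀ θ : ℝ, circleMap 0 ρ θ ∈ Metric.closedBall (0 : ℂ) ρ := fun θ =>
    circleMap_mem_closedBall _ hρ.le θ
  have hrepr : ∀ x ∈ Metric.ball x₀ r, fderiv ℂ f x v =
      (2 * Real.pi * Complex.I : ℂ)⁻¹ • ∫ θ in (0 : ℝ)..2 * Real.pi,
        (deriv (circleMap 0 ρ) θ * ((circleMap 0 ρ θ) ^ 2)⁻¹) * f (x + circleMap 0 ρ θ • v) := by
    intro x hx
    have hd : DifferentiableOn ℂ (fun τ : ℂ => f (x + τ • v)) (Metric.closedBall (0 : ℂ) ρ) :=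
      fun τ hτ => ((hdiff _ (hmem x hx τ hτ)).comp τ
        (hline x τ).differentiableAt).differentiableWithinAt
    have hdc : DiffContOnCl ℂ (fun τ : ℂ => f (x + τ • v)) (Metric.ball (0 : ℂ) ρ) :=
      DifferentiableOn.diffContOnCl_ball hd subset_rfl
    have hx' : HasFDerivAt f (fderiv ℂ f x) (x + (0 : ℂ) • v) := by
      rw [zero_smul, add_zero]
      exact (hdiff x (Metric.ball_subset_ball (by linarith) hx)).hasFDerivAt
    have h1 : deriv (fun τ : ℂ => f (x + τ • v)) 0 = fderiv ℂ f x v :=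
      (hx'.comp_hasDerivAt (0 : ℂ) (hline x 0)).deriv
    have h2 := hdc.deriv_eq_smul_circleIntegral hρ
    rw [h1] at h2
    rw [eq_inv_smul_iff₀ Complex.two_pi_I_ne_zero, ← h2]
    simp only [circleIntegral, sub_zero, smul_eq_mul, one_div, mul_assoc]
  have hcm : Continuous (circleMap 0 ρ) := continuous_circleMap 0 ρ
  have hk : Continuous fun θ : ℝ => deriv (circleMap 0 ρ) θ * ((circleMap 0 ρ θ) ^ 2)⁻¹ := by
    have h0 : ∀ θ, circleMap 0 ρ θ ≠ 0 := fun θ => circleMap_ne_center hρ.ne'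
    simp only [deriv_circleMap]
    exact (hcm.mul continuous_const).mul ((hcm.pow 2).inv₀ fun θ => pow_ne_zero 2 (h0 θ))
  have hcont : ∀ x ∈ Metric.ball x₀ r, Continuous fun θ : ℝ =>
      (deriv (circleMap 0 ρ) θ * ((circleMap 0 ρ θ) ^ 2)⁻¹) * f (x + circleMap 0 ρ θ • v) := by
    intro x hx
    refine hk.mul (continuous_iff_continuousAt.2 fun θ => ?_)
    exact (hdiff _ (hmem x hx _ (hcirc θ))).continuousAt.comp_of_eq
      (by fun_prop : Continuous fun θ : ℝ => x + circleMap 0 ρ θ • v).continuousAt rfl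
  have hx₀r : x₀ ∈ Metric.ball x₀ r := Metric.mem_ball_self hr
  have main := intervalIntegral.hasFDerivAt_integral_of_dominated_of_fderiv_le (𝕜 := ℂ)
    (μ := MeasureTheory.volume) (a := 0) (b := 2 * Real.pi) (s := Metric.ball x₀ r)
    (F := fun x θ => (deriv (circleMap 0 ρ) θ * ((circleMap 0 ρ θ) ^ 2)⁻¹) *
      f (x + circleMap 0 ρ θ • v))
    (F' := fun x θ => (deriv (circleMap 0 ρ) θ * ((circleMap 0 ρ θ) ^ 2)⁻¹) •
      fderiv ℂ f (x + circleMap 0 ρ θ • v))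
    (x₀ := x₀)
    (bound := fun θ => ‖deriv (circleMap 0 ρ) θ * ((circleMap 0 ρ θ) ^ 2)⁻¹‖ * (C / r))
    (Metric.ball_mem_nhds x₀ hr)
    (by
      filter_upwards [Metric.ball_mem_nhds x₀ hr] with x hx
      exact (hcont x hx).aestronglyMeasurable)
    ((hcont x₀ hx₀r).intervalIntegrable _ _)
    (by
      -- Measurability of the derivative is enough here; its continuity is not needed.
      refine hk.aestronglyMeasurable.smul (Measurable.aestronglyMeasurable ?_)
      exact (measurable_fderiv ℂ f).comp
        (by fun_prop : Continuous fun θ : ℝ => x₀ + circleMap 0 ρ θ • v).measurable)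
    (by
      refine Eventually.of_forall fun θ _ x hx => ?_
      rw [norm_smul]
      exact mul_le_mul_of_nonneg_left (hbound _ (hmem x hx _ (hcirc θ))) (norm_nonneg _))
    ((hk.norm.mul continuous_const).intervalIntegrable _ _)
    (by
      refine Eventually.of_forall fun θ _ x hx => ?_
      have h1 := (hdiff _ (hmem x hx _ (hcirc θ))).hasFDerivAt.comp x
        ((hasFDerivAt_id x).add_const (circleMap 0 ρ θ • v))
      exact h1.const_mul _)
  refine DifferentiableAt.congr_of_eventuallyEq (main.differentiableAt.const_smul
    ((2 * Real.pi * Complex.I : ℂ)⁻¹)) ?_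
  filter_upwards [Metric.ball_mem_nhds x₀ hr] with x hx
  exact hrepr x hx

end HolomorphicDerivative

/-! ### Third-order Taylor expansion along polynomial curves -/

section Expansion

theorem isBigO_sub_of_hasDerivAt_isBigO {F F' : ℝ → ℂ} {n : ℕ}
    (hF : ∀ᶠ t in 𝓝 (0 : ℝ), HasDerivAt F (F' t) t)
    (hF' : F' =O[𝓝 0] fun t : ℝ => t ^ n) :
    (fun t => F t - F 0) =O[𝓝 0] fun t : ℝ => t ^ (n + 1) := by
  obtain ⟨C, hC0, hC⟩ := hF'.exists_nonneg
  obtain ⟨δ, hδ, h⟩ := Metric.eventually_nhds_iff_ball.1 (hF.and hC.bound)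
  refine IsBigO.of_bound C ?_
  filter_upwards [Metric.ball_mem_nhds (0 : ℝ) hδ] with t ht
  have hsub : ∀ x ∈ Set.uIcc 0 t, x ∈ Metric.ball (0 : ℝ) δ ∧ |x| ≤ |t| := by
    intro x hx
    have hx' : |x| ≤ |t| := by simpa using Set.abs_sub_left_of_mem_uIcc hx
    rw [mem_ball_zero_iff, Real.norm_eq_abs] at ht ⊢
    exact ⟨hx'.trans_lt ht, hx'⟩
  have key := (convex_uIcc (0 : ℝ) t).norm_image_sub_le_of_norm_hasDerivWithin_le
    (f := F) (f' := F') (C := C * |t| ^ n)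
    (fun x hx => (h x (hsub x hx).1).1.hasDerivWithinAt)
    (fun x hx => (h x (hsub x hx).1).2.trans (by
      rw [norm_pow, Real.norm_eq_abs]
      exact mul_le_mul_of_nonneg_left (pow_le_pow_left₀ (abs_nonneg x) (hsub x hx).2 n) hC0))
    Set.left_mem_uIcc Set.right_mem_uIcc
  simpa [pow_succ, mul_assoc] using key

/-- Peels off one coefficient: the limit at `0` gives `c = 0`, and the rest is divided by `t`, hence
the punctured neighbourhood. -/
theorem eq_zero_and_isBigO_of_add_mul_isBigO {c : ℝ} {p : ℝ → ℝ} {n : ℕ}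
    (hp : ContinuousAt p 0)
    (h : (fun t => c + t * p t) =O[𝓝[≠] 0] fun t : ℝ => t ^ (n + 1)) :
    c = 0 ∧ p =O[𝓝[≠] 0] fun t : ℝ => t ^ n := by
  have h0 : c = 0 := by
    have h1 : Tendsto (fun t : ℝ => t ^ (n + 1)) (𝓝[≠] 0) (𝓝 0) := by
      have : Tendsto (fun t : ℝ => t ^ (n + 1)) (𝓝 0) (𝓝 (0 ^ (n + 1))) :=
        (continuous_pow (n + 1)).tendsto 0
      rw [zero_pow n.succ_ne_zero] at this
      exact this.mono_left nhdsWithin_le_nhds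
    have h2 : Tendsto (fun t => c + t * p t) (𝓝[≠] 0) (𝓝 (c + 0 * p 0)) :=
      (tendsto_const_nhds.add (tendsto_id.mul hp.tendsto)).mono_left nhdsWithin_le_nhds
    simpa using tendsto_nhds_unique h2 (h.trans_tendsto h1)
  refine ⟨h0, ?_⟩
  subst h0
  have h3 := (isBigO_refl (fun t : ℝ => t⁻¹) (𝓝[≠] 0)).mul h
  refine h3.congr' ?_ ?_
  · filter_upwards [self_mem_nhdsWithin] with t (ht : t ≠ 0)
    field_simp
    ring
  · filter_upwards [self_mem_nhdsWithin] with t (ht : t ≠ 0)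
    rw [pow_succ', inv_mul_cancel_left₀ ht]

theorem coeff_eq_zero_of_isBigO {c₀ c₁ c₂ c₃ : ℝ}
    (h : (fun t : ℝ => c₀ + t * (c₁ + t * (c₂ + t * c₃))) =O[𝓝 0] fun t : ℝ => t ^ 4) :
    c₁ = 0 ∧ c₂ = 0 ∧ c₃ = 0 := by
  obtain ⟨-, h₁⟩ := eq_zero_and_isBigO_of_add_mul_isBigO (by fun_prop)
    (h.mono nhdsWithin_le_nhds)
  obtain ⟨e₁, h₂⟩ := eq_zero_and_isBigO_of_add_mul_isBigO (by fun_prop) h₁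
  obtain ⟨e₂, h₃⟩ := eq_zero_and_isBigO_of_add_mul_isBigO (by fun_prop) h₂
  have h₃' : (fun t : ℝ => c₃ + t * 0) =O[𝓝[≠] 0] fun t : ℝ => t ^ (0 + 1) := by simpa using h₃
  exact ⟨e₁, e₂, (eq_zero_and_isBigO_of_add_mul_isBigO (by fun_prop) h₃').1⟩

variable {E : Type*} [NormedAddCommGroup E] [NormedSpace ℂ E]

/-- The curve `t ↦ t A + t² B + t³ C + t⁴ D`. -/
noncomputable def quarticCurve (A B C D : E) (t : ℝ) : E :=
  (t : ℂ) • A + (t : ℂ) ^ 2 • B + (t : ℂ) ^ 3 • C + (t : ℂ) ^ 4 • D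

theorem quarticCurve_zero (A B C D : E) : quarticCurve A B C D 0 = 0 := by
  simp [quarticCurve]

theorem hasDerivAt_quarticCurve (A B C D : E) (t : ℝ) :
    HasDerivAt (quarticCurve A B C D)
      (A + (2 * (t : ℂ)) • B + (3 * (t : ℂ) ^ 2) • C + (4 * (t : ℂ) ^ 3) • D) t := by
  have h : HasDerivAt (fun τ : ℂ => τ • A + τ ^ 2 • B + τ ^ 3 • C + τ ^ 4 • D)
      (A + (2 * (t : ℂ)) • B + (3 * (t : ℂ) ^ 2) • C + (4 * (t : ℂ) ^ 3) • D) (t : ℂ) := by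
    have h1 := (hasDerivAt_id (t : ℂ)).smul_const A
    have h2 := (hasDerivAt_pow 2 (t : ℂ)).smul_const B
    have h3 := (hasDerivAt_pow 3 (t : ℂ)).smul_const C
    have h4 := (hasDerivAt_pow 4 (t : ℂ)).smul_const D
    exact (((h1.add h2).add h3).add h4).congr_deriv (by simp)
  exact (h.scomp t Complex.ofRealCLM.hasDerivAt).congr_deriv (by simp)

variable {U : Set E} (A B C D : E)

theorem eventually_quarticCurve_mem (hU : IsOpen U) (h0 : (0 : E) ∈ U) :
    ∀ᶠ t in 𝓝 (0 : ℝ), quarticCurve A B C D t ∈ U :=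
  (hasDerivAt_quarticCurve A B C D 0).continuousAt.eventually_mem
    (by rw [quarticCurve_zero]; exact hU.mem_nhds h0)

/-- The derivative along the curve is a combination of the holomorphic functions `fderiv ℂ φ · v` on
the same curve. Each expansion below thus follows by integrating expansions of lower order for these
functions. -/
theorem hasDerivAt_comp_quarticCurve {φ : E → ℂ} (hU : IsOpen U) (h0 : (0 : E) ∈ U)
    (hφ : DifferentiableOn ℂ φ U) :
    ∀ᶠ t in 𝓝 (0 : ℝ), HasDerivAt (fun t => φ (quarticCurve A B C D t))
      (fderiv ℂ φ (quarticCurve A B C D t) A + t * (2 * fderiv ℂ φ (quarticCurve A B C D t) B)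
        + t ^ 2 * (3 * fderiv ℂ φ (quarticCurve A B C D t) C)
        + t ^ 3 * (4 * fderiv ℂ φ (quarticCurve A B C D t) D)) t := by
  filter_upwards [eventually_quarticCurve_mem A B C D hU h0] with t ht
  have h1 := ((hφ.differentiableAt (hU.mem_nhds ht)).hasFDerivAt.restrictScalars ℝ).comp_hasDerivAt
    t (hasDerivAt_quarticCurve A B C D t)
  refine h1.congr_deriv ?_
  simp only [ContinuousLinearMap.coe_restrictScalars', map_add, map_smul, smul_eq_mul]
  ring

theorem continuousAt_comp_quarticCurve {φ : E → ℂ} (hU : IsOpen U) (h0 : (0 : E) ∈ U)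
    (hφ : DifferentiableOn ℂ φ U) :
    ContinuousAt (fun t => φ (quarticCurve A B C D t)) 0 :=
  (hasDerivAt_comp_quarticCurve A B C D hU h0 hφ).self_of_nhds.continuousAt

theorem isBigO_pow_mul_of_continuousAt {F : ℝ → ℂ} (hF : ContinuousAt F 0) (n : ℕ) :
    (fun t : ℝ => (t : ℂ) ^ n * F t) =O[𝓝 0] fun t : ℝ => t ^ n := by
  have h1 : (fun t : ℝ => (t : ℂ) ^ n) =O[𝓝 0] fun t : ℝ => t ^ n :=
    IsBigO.of_bound 1 (by simp)
  simpa using h1.mul (hF.norm.isBoundedUnder_le.isBigO_one ℝ)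

theorem isBigO_pow_mul {F : ℝ → ℂ} {m : ℕ} (hF : F =O[𝓝 0] fun t : ℝ => t ^ m) (n : ℕ) :
    (fun t : ℝ => (t : ℂ) ^ n * F t) =O[𝓝 0] fun t : ℝ => t ^ (n + m) := by
  have h1 : (fun t : ℝ => (t : ℂ) ^ n) =O[𝓝 0] fun t : ℝ => t ^ n :=
    IsBigO.of_bound 1 (by simp)
  simpa [pow_add] using h1.mul hF

variable [FiniteDimensional ℂ E]

section
variable {φ : E → ℂ} (hU : IsOpen U) (h0 : (0 : E) ∈ U) (hφ : DifferentiableOn ℂ φ U)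
include hU h0 hφ

theorem isBigO_comp_quarticCurve_sub_taylor_zero :
    (fun t => φ (quarticCurve A B C D t) - φ 0) =O[𝓝 0] fun t : ℝ => t ^ 1 := by
  have hv := fun v => continuousAt_comp_quarticCurve A B C D hU h0
    (differentiableOn_fderiv_apply hU hφ v)
  have := isBigO_sub_of_hasDerivAt_isBigO (n := 0)
    (hasDerivAt_comp_quarticCurve A B C D hU h0 hφ) (by
      simp only [pow_zero]
      refine IsBigO.add (IsBigO.add (IsBigO.add ?_ ?_) ?_) ?_
      all_goals refine (ContinuousAt.norm ?_).isBoundedUnder_le.isBigO_one ℝ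
      · exact hv A
      · exact (Complex.continuous_ofReal.continuousAt).mul (continuousAt_const.mul (hv B))
      · exact (Complex.continuous_ofReal.continuousAt.pow 2).mul (continuousAt_const.mul (hv C))
      · exact (Complex.continuous_ofReal.continuousAt.pow 3).mul (continuousAt_const.mul (hv D)))
  simpa [quarticCurve_zero] using this

theorem isBigO_comp_quarticCurve_sub_taylor_one :
    (fun t => φ (quarticCurve A B C D t) - φ 0 - t * fderiv ℂ φ 0 A)
      =O[𝓝 0] fun t : ℝ => t ^ 2 := by
  have hv := fun v => continuousAt_comp_quarticCurve A B C D hU h0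
    (differentiableOn_fderiv_apply hU hφ v)
  have e := fun v => isBigO_comp_quarticCurve_sub_taylor_zero A B C D hU h0 (differentiableOn_fderiv_apply hU hφ v)
  have hd : ∀ᶠ t in 𝓝 (0 : ℝ), HasDerivAt
      (fun t : ℝ => φ (quarticCurve A B C D t) - φ 0 - t * fderiv ℂ φ 0 A) _ t :=
    (hasDerivAt_comp_quarticCurve A B C D hU h0 hφ).mono fun t ht =>
      (ht.sub_const _).sub ((hasDerivAt_id (t : ℂ)).comp_ofReal.mul_const _)
  have := isBigO_sub_of_hasDerivAt_isBigO (n := 1) hd (by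
      have h1 := isBigO_pow_mul_of_continuousAt (continuousAt_const.mul (hv B) :
        ContinuousAt (fun t => 2 * fderiv ℂ φ (quarticCurve A B C D t) B) 0) 1
      have h2 := isBigO_pow_mul_of_continuousAt (Complex.continuous_ofReal.continuousAt.mul
        (continuousAt_const.mul (hv C)) :
        ContinuousAt (fun t : ℝ => (t : ℂ) * (3 * fderiv ℂ φ (quarticCurve A B C D t) C)) 0) 1
      have h3 := isBigO_pow_mul_of_continuousAt ((Complex.continuous_ofReal.continuousAt.pow 2).mul
        (continuousAt_const.mul (hv D)) :
        ContinuousAt (fun t : ℝ => (t : ℂ) ^ 2 *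
          (4 * fderiv ℂ φ (quarticCurve A B C D t) D)) 0) 1
      refine ((((e A).add h1).add h2).add h3).congr_left fun t => ?_
      simp only [Pi.mul_apply, Pi.pow_apply]
      ring)
  simpa [quarticCurve_zero] using this

theorem isBigO_comp_quarticCurve_sub_taylor_two :
    (fun t => φ (quarticCurve A B C D t) - φ 0 - t * fderiv ℂ φ 0 A
        - t ^ 2 * (fderiv ℂ (fun x => fderiv ℂ φ x A) 0 A / 2 + fderiv ℂ φ 0 B))
      =O[𝓝 0] fun t : ℝ => t ^ 3 := by
  have hv := fun v => continuousAt_comp_quarticCurve A B C D hU h0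
    (differentiableOn_fderiv_apply hU hφ v)
  have e := fun v => isBigO_comp_quarticCurve_sub_taylor_zero A B C D hU h0 (differentiableOn_fderiv_apply hU hφ v)
  have e' := fun v => isBigO_comp_quarticCurve_sub_taylor_one A B C D hU h0 (differentiableOn_fderiv_apply hU hφ v)
  have hd : ∀ᶠ t in 𝓝 (0 : ℝ), HasDerivAt
      (fun t : ℝ => φ (quarticCurve A B C D t) - φ 0 - t * fderiv ℂ φ 0 A
        - t ^ 2 * (fderiv ℂ (fun x => fderiv ℂ φ x A) 0 A / 2 + fderiv ℂ φ 0 B)) _ t :=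
    (hasDerivAt_comp_quarticCurve A B C D hU h0 hφ).mono fun t ht =>
      ((ht.sub_const _).sub ((hasDerivAt_id (t : ℂ)).comp_ofReal.mul_const _)).sub
        ((hasDerivAt_pow 2 (t : ℂ)).comp_ofReal.mul_const _)
  have := isBigO_sub_of_hasDerivAt_isBigO (n := 2) hd (by
      have h1 := isBigO_pow_mul ((e B).const_mul_left 2) 1
      have h2 := isBigO_pow_mul_of_continuousAt (continuousAt_const.mul (hv C) :
        ContinuousAt (fun t : ℝ => 3 * fderiv ℂ φ (quarticCurve A B C D t) C) 0) 2
      have h3 := isBigO_pow_mul_of_continuousAt (Complex.continuous_ofReal.continuousAt.mul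
        (continuousAt_const.mul (hv D)) :
        ContinuousAt (fun t : ℝ => (t : ℂ) *
          (4 * fderiv ℂ φ (quarticCurve A B C D t) D)) 0) 2
      refine ((((e' A).add h1).add h2).add h3).congr_left fun t => ?_
      simp only [Pi.mul_apply]
      push_cast
      ring)
  simpa [quarticCurve_zero] using this

/-- The mixed second derivative in `A` and `B` occurs in both orders, with weights `1/3` and `2/3`,
because symmetry is not invoked: the first comes from expanding the derivative along `A`, the second
from `2t` times the derivative along `B`. -/
theorem isBigO_comp_quarticCurve_sub_taylor_three :
    (fun t => φ (quarticCurve A B C D t) - φ 0 - t * fderiv ℂ φ 0 A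
        - t ^ 2 * (fderiv ℂ (fun x => fderiv ℂ φ x A) 0 A / 2 + fderiv ℂ φ 0 B)
        - t ^ 3 * (fderiv ℂ (fun x => fderiv ℂ (fun y => fderiv ℂ φ y A) x A) 0 A / 6
          + fderiv ℂ (fun x => fderiv ℂ φ x A) 0 B / 3
          + 2 * fderiv ℂ (fun x => fderiv ℂ φ x B) 0 A / 3 + fderiv ℂ φ 0 C))
      =O[𝓝 0] fun t : ℝ => t ^ 4 := by
  have hv := fun v => continuousAt_comp_quarticCurve A B C D hU h0
    (differentiableOn_fderiv_apply hU hφ v)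
  have e := fun v => isBigO_comp_quarticCurve_sub_taylor_zero A B C D hU h0 (differentiableOn_fderiv_apply hU hφ v)
  have e' := fun v => isBigO_comp_quarticCurve_sub_taylor_one A B C D hU h0 (differentiableOn_fderiv_apply hU hφ v)
  have e'' := fun v => isBigO_comp_quarticCurve_sub_taylor_two A B C D hU h0 (differentiableOn_fderiv_apply hU hφ v)
  have hd : ∀ᶠ t in 𝓝 (0 : ℝ), HasDerivAt
      (fun t : ℝ => φ (quarticCurve A B C D t) - φ 0 - t * fderiv ℂ φ 0 A
        - t ^ 2 * (fderiv ℂ (fun x => fderiv ℂ φ x A) 0 A / 2 + fderiv ℂ φ 0 B)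
        - t ^ 3 * (fderiv ℂ (fun x => fderiv ℂ (fun y => fderiv ℂ φ y A) x A) 0 A / 6
          + fderiv ℂ (fun x => fderiv ℂ φ x A) 0 B / 3
          + 2 * fderiv ℂ (fun x => fderiv ℂ φ x B) 0 A / 3 + fderiv ℂ φ 0 C)) _ t :=
    (hasDerivAt_comp_quarticCurve A B C D hU h0 hφ).mono fun t ht =>
      (((ht.sub_const _).sub ((hasDerivAt_id (t : ℂ)).comp_ofReal.mul_const _)).sub
        ((hasDerivAt_pow 2 (t : ℂ)).comp_ofReal.mul_const _)).sub
        ((hasDerivAt_pow 3 (t : ℂ)).comp_ofReal.mul_const _)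
  have := isBigO_sub_of_hasDerivAt_isBigO (n := 3) hd (by
      have h1 := isBigO_pow_mul ((e' B).const_mul_left 2) 1
      have h2 := isBigO_pow_mul ((e C).const_mul_left 3) 2
      have h3 := isBigO_pow_mul_of_continuousAt (continuousAt_const.mul (hv D) :
        ContinuousAt (fun t : ℝ => 4 * fderiv ℂ φ (quarticCurve A B C D t) D) 0) 3
      refine ((((e'' A).add h1).add h2).add h3).congr_left fun t => ?_
      simp only [Pi.mul_apply]
      push_cast
      ring)
  simpa [quarticCurve_zero] using this

/-- If `Im φ` vanishes to fourth order along `t ↦ t A + t² B + t³ C + t⁴ D`, then the Taylor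
coefficients of order one, two and three of `φ` along this curve are real. -/
theorem im_coeff_eq_zero
    (him : (fun t => (φ (quarticCurve A B C D t)).im) =O[𝓝 0] fun t : ℝ => t ^ 4) :
    (fderiv ℂ φ 0 A).im = 0 ∧
    (fderiv ℂ (fun x => fderiv ℂ φ x A) 0 A / 2 + fderiv ℂ φ 0 B).im = 0 ∧
    (fderiv ℂ (fun x => fderiv ℂ (fun y => fderiv ℂ φ y A) x A) 0 A / 6
          + fderiv ℂ (fun x => fderiv ℂ φ x A) 0 B / 3
          + 2 * fderiv ℂ (fun x => fderiv ℂ φ x B) 0 A / 3 + fderiv ℂ φ 0 C).im = 0 := by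
  have h := isBigO_comp_quarticCurve_sub_taylor_three A B C D hU h0 hφ
  set c₁ := fderiv ℂ φ 0 A
  set c₂ := fderiv ℂ (fun x => fderiv ℂ φ x A) 0 A / 2 + fderiv ℂ φ 0 B
  set c₃ := fderiv ℂ (fun x => fderiv ℂ (fun y => fderiv ℂ φ y A) x A) 0 A / 6
          + fderiv ℂ (fun x => fderiv ℂ φ x A) 0 B / 3
          + 2 * fderiv ℂ (fun x => fderiv ℂ φ x B) 0 A / 3 + fderiv ℂ φ 0 C
  have h' := (IsBigO.of_bound 1 (Eventually.of_forall fun t => by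
    rw [one_mul, Real.norm_eq_abs]
    exact Complex.abs_im_le_norm _) : (fun t : ℝ => (φ (quarticCurve A B C D t) - φ 0
      - t * c₁ - t ^ 2 * c₂ - t ^ 3 * c₃).im) =O[𝓝 0] _).trans h
  refine coeff_eq_zero_of_isBigO (c₀ := (φ 0).im) ((him.sub h').congr_left fun t => ?_)
  simp only [← Complex.ofReal_pow, Complex.sub_im, Complex.im_ofReal_mul]
  ring

end

end Expansion

/-! ### Germs with almost real values on the perturbed surface -/

section Rigidity

/-- The surface obtained from `Q_{a,b,c}` by adding the cubic term `-2 s Im (z² z̄)` to the last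
defining equation. For `s ≠ 0` both cubic commutators are present at the origin. -/
def perturbedSurface (s a b c : ℝ) : Set C4 :=
  {p | (p 1).im = ‖p 0‖ ^ 2 ∧
       (p 2).im = 2 * ((p 0) ^ 2 * conj (p 0)).re ∧
       (p 3).im = -2 * s * ((p 0) ^ 2 * conj (p 0)).im + a * ‖p 0‖ ^ 4
          + 2 * b * ((p 0) ^ 3 * conj (p 0)).re - 2 * c * ((p 0) ^ 3 * conj (p 0)).im}

theorem Complex.norm_pow_four (z : ℂ) : ‖z‖ ^ 4 = (z.re ^ 2 + z.im ^ 2) ^ 2 := by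
  rw [show 4 = 2 * 2 from rfl, pow_mul, Complex.sq_norm, Complex.normSq_apply]
  ring

theorem Complex.norm_pow_two (z : ℂ) : ‖z‖ ^ 2 = z.re ^ 2 + z.im ^ 2 := by
  rw [Complex.sq_norm, Complex.normSq_apply]
  ring

/-- Over the line `t z` the defining polynomials split by degree in `t`: `B`, `C`, `D` carry degrees
two, three and four. The real parts `u₁ t²`, `u₂ t³`, `u₃ t³` are free and serve as test parameters.
-/
theorem quarticCurve_mem_perturbedSurface (s a b c : ℝ) (z : ℂ) (u₁ u₂ u₃ t : ℝ) :
    quarticCurve (z • Pi.single 0 1 : C4)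
      ((u₁ + ‖z‖ ^ 2 * Complex.I) • Pi.single 1 1)
      ((u₂ + (2 * (z ^ 2 * conj z).re : ℝ) * Complex.I) • Pi.single 2 1
        + (u₃ + (-2 * s * (z ^ 2 * conj z).im : ℝ) * Complex.I) • Pi.single 3 1)
      (((a * ‖z‖ ^ 4 + 2 * b * (z ^ 3 * conj z).re - 2 * c * (z ^ 3 * conj z).im : ℝ) * Complex.I)
        • Pi.single 3 1) t ∈ perturbedSurface s a b c := by
  have h2 := Complex.norm_pow_two z
  simp only [perturbedSurface, Set.mem_ofPred_eq, quarticCurve, Pi.add_apply, Pi.smul_apply,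
    smul_eq_mul, Complex.norm_pow_two, Complex.norm_pow_four]
  refine ⟨?_, ?_, ?_⟩
  · simp [← Complex.ofReal_pow, h2]
    ring
  · simp [pow_succ]
    ring
  · simp [pow_succ]
    ring

theorem fderiv_fderiv_smul {φ : C4 → ℂ} {U : Set C4} (hU : IsOpen U) (h0 : (0 : C4) ∈ U)
    (hφ : DifferentiableOn ℂ φ U) (v : C4) (k : ℂ) (w : C4) :
    fderiv ℂ (fun x => fderiv ℂ φ x (k • v)) 0 w = k * fderiv ℂ (fun x => fderiv ℂ φ x v) 0 w := by
  simp only [map_smul, smul_eq_mul]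
  rw [fderiv_const_mul ((differentiableOn_fderiv_apply hU hφ v).differentiableAt
    (hU.mem_nhds h0))]
  rfl

/-- A germ of a holomorphic function whose imaginary part vanishes to fourth order along
`perturbedSurface s a b c`, `s ≠ 0`, is critical at the origin. -/
theorem fderiv_eq_zero_of_im_isBigO {φ : C4 → ℂ} {U : Set C4} (hU : IsOpen U)
    (h0 : (0 : C4) ∈ U) (hφ : DifferentiableOn ℂ φ U) {s a b c : ℝ} (hs : s ≠ 0)
    (him : ∀ γ : ℝ → C4, DifferentiableAt ℝ γ 0 → γ 0 = 0 →
      (∀ t, γ t ∈ perturbedSurface s a b c) →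
      (fun t => (φ (γ t)).im) =O[𝓝 0] fun t : ℝ => t ^ 4) :
    fderiv ℂ φ 0 = 0 := by
  have hcoeff : ∀ (z : ℂ) (u₁ u₂ u₃ : ℝ), _ := fun z u₁ u₂ u₃ =>
    im_coeff_eq_zero _ _ _ _ hU h0 hφ (him _
      (hasDerivAt_quarticCurve _ _ _ _ 0).differentiableAt (quarticCurve_zero _ _ _ _)
      (quarticCurve_mem_perturbedSurface s a b c z u₁ u₂ u₃))
  set e₀ : C4 := Pi.single 0 1
  set e₁ : C4 := Pi.single 1 1
  set e₂ : C4 := Pi.single 2 1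
  set e₃ : C4 := Pi.single 3 1
  have hA3 : ∀ z : ℂ, fderiv ℂ (fun x => fderiv ℂ (fun y => fderiv ℂ φ y (z • e₀)) x (z • e₀)) 0
      (z • e₀) = z ^ 3 *
        fderiv ℂ (fun x => fderiv ℂ (fun y => fderiv ℂ φ y e₀) x e₀) 0 e₀ := by
    intro z
    have hd := differentiableOn_fderiv_apply hU hφ e₀
    rw [fderiv_fderiv_smul hU h0 (differentiableOn_fderiv_apply hU hφ (z • e₀)), map_smul]
    have : (fun x => fderiv ℂ (fun y => fderiv ℂ φ y (z • e₀)) x e₀) =ᶠ[𝓝 0]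
        fun x => z * fderiv ℂ (fun y => fderiv ℂ φ y e₀) x e₀ := by
      filter_upwards [hU.mem_nhds h0] with x hx
      simp only [map_smul, smul_eq_mul]
      rw [fderiv_const_mul (hd.differentiableAt (hU.mem_nhds hx))]
      rfl
    rw [this.fderiv_eq, fderiv_const_mul ((differentiableOn_fderiv_apply hU hd e₀).differentiableAt
      (hU.mem_nhds h0))]
    simp only [smul_apply, smul_eq_mul]
    ring
  simp only [hA3, fderiv_fderiv_smul hU h0 hφ] at hcoeff
  simp only [map_smul, map_add, smul_eq_mul] at hcoeff
  set l₀ := fderiv ℂ φ 0 e₀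
  set l₁ := fderiv ℂ φ 0 e₁
  set l₂ := fderiv ℂ φ 0 e₂
  set l₃ := fderiv ℂ φ 0 e₃
  set q := fderiv ℂ (fun x => fderiv ℂ φ x e₀) 0 e₀
  set m := fderiv ℂ (fun x => fderiv ℂ φ x e₀) 0 e₁
  set m' := fderiv ℂ (fun x => fderiv ℂ φ x e₁) 0 e₀
  set k := fderiv ℂ (fun x => fderiv ℂ (fun y => fderiv ℂ φ y e₀) x e₀) 0 e₀
  have H1 := fun z => (hcoeff z 0 0 0).1
  have H2 := fun z u => (hcoeff z u 0 0).2.1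
  have H3 := fun z u₁ u₂ u₃ => (hcoeff z u₁ u₂ u₃).2.2
  clear hcoeff him hA3
  have E0 : l₀ = 0 := by
    have h1 := H1 1
    have h2 := H1 Complex.I
    exact Complex.ext (by simpa using h2) (by simpa using h1)
  -- `z = 0` gives the imaginary part; `z = 1` and `z = i` have opposite squares, so adding them
  -- eliminates `q` and gives the real part.
  have E1 : l₁ = 0 := by
    have h0 := H2 0 1
    have h1 := H2 1 0
    have h2 := H2 Complex.I 0
    simp at h0 h1 h2
    refine Complex.ext ?_ ?_ <;> simp <;> linarith
  -- Tests with `z = 0` give the imaginary parts. Comparing `u₁ = 1` with `u₁ = 0` kills the mixed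
  -- derivatives, and the values at `1`, `i`, `1 ± i` separate `|z|² Re z` and `|z|² Im z` from the
  -- remaining `z³` term.
  have E23 : l₂ = 0 ∧ l₃ = 0 := by
    have a0 := H3 0 0 1 0
    have a1 := H3 0 0 0 1
    have a2 := H3 1 0 0 0
    have a3 := H3 Complex.I 0 0 0
    have a4 := H3 (1 + Complex.I) 0 0 0
    have a5 := H3 (1 - Complex.I) 0 0 0
    have b1 := H3 1 1 0 0
    have b2 := H3 Complex.I 1 0 0
    have hI := Complex.norm_pow_two (1 + Complex.I)
    have hI' := Complex.norm_pow_two (1 - Complex.I)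
    norm_num at hI hI'
    simp at a0 a1
    simp [pow_succ, a0, a1] at a2 a3 a4 a5 b1 b2
    rw [pow_two] at hI hI'
    rw [hI] at a4
    rw [hI'] at a5
    have c2 : l₂.re = 0 := by linarith
    have c3 : s * l₃.re = 0 := by linarith
    exact ⟨Complex.ext c2 a0, Complex.ext ((mul_eq_zero.1 c3).resolve_left hs) a1⟩
  obtain ⟨E2, E3⟩ := E23
  ext v
  have hv : v = v 0 • e₀ + v 1 • e₁ + v 2 • e₂ + v 3 • e₃ := by
    ext i
    fin_cases i <;> simp [e₀, e₁, e₂, e₃]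
  rw [hv]
  simp only [map_add, map_smul]
  simp [l₀, l₁, l₂, l₃] at E0 E1 E2 E3
  simp [E0, E1, E2, E3]

/-- For `s ≠ 0` the germ of `perturbedSurface s a b c` at the origin is not biholomorphic to the
germ of `Q_{a,b,c}` at the origin. -/
theorem not_exists_biholomorphism_of_perturbedSurface {s a b c : ℝ} (hs : s ≠ 0)
    {e : OpenPartialHomeomorph C4 C4} (he : IsBiholomorphism e) (h0 : (0 : C4) ∈ e.source)
    (he0 : e 0 = 0)
    (hmap : ∀ x ∈ e.source, x ∈ perturbedSurface s a b c → e x ∈ modelSurface a b c) : False := by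
  have hd := (he.1.differentiableAt (e.open_source.mem_nhds h0)).hasFDerivAt
  have h0' : (0 : C4) ∈ e.target := he0 ▸ e.map_source h0
  have hd' := (he.2.differentiableAt (e.open_target.mem_nhds h0')).hasFDerivAt
  have hs0 : e.symm 0 = 0 := by
    have := e.left_inv h0
    rwa [he0] at this
  have hφ : DifferentiableOn ℂ (fun x => e x 3) e.source := fun x hx =>
    differentiableWithinAt_pi.1 (he.1 x hx) 3
  have hcrit : fderiv ℂ (fun x => e x 3) 0 = 0 := by
    -- Along a curve through the origin the first component of `e` is `O(t)`, and the last equation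
    -- of `Q_{a,b,c}` is homogeneous of degree four in it.
    refine fderiv_eq_zero_of_im_isBigO e.open_source h0 hφ hs (a := a) (b := b) (c := c)
      fun γ hγ hγ0 hγS => ?_
    have hz : (fun t => e (γ t) 0) =O[𝓝 0] fun t : ℝ => t := by
      have h1 : DifferentiableAt ℝ (fun t => e (γ t) 0) 0 := by
        have h2 : DifferentiableAt ℝ (fun t => e (γ t)) 0 := by
          refine DifferentiableAt.comp (0 : ℝ) ?_ hγ
          rw [hγ0]
          exact hd.differentiableAt.restrictScalars ℝ
        exact differentiableAt_pi.1 h2 0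
      simpa [hγ0, he0] using h1.isBigO_sub
    have hev : ∀ᶠ t in 𝓝 (0 : ℝ), γ t ∈ e.source :=
      hγ.continuousAt.eventually_mem (by rw [hγ0]; exact e.open_source.mem_nhds h0)
    refine IsBigO.trans (IsBigO.of_bound (|a| + 2 * |b| + 2 * |c|) ?_) (hz.norm_left.pow 4)
    filter_upwards [hev] with t ht
    rw [(hmap _ ht (hγS t)).2.2]
    set z := e (γ t) 0
    have hre := Complex.abs_re_le_norm (z ^ 3 * conj z)
    have him := Complex.abs_im_le_norm (z ^ 3 * conj z)
    have hn : ‖z ^ 3 * conj z‖ = ‖z‖ ^ 4 := by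
      rw [norm_mul, norm_pow, RCLike.norm_conj]
      ring
    rw [hn] at hre him
    rw [Real.norm_eq_abs, Real.norm_eq_abs, abs_pow, abs_norm]
    calc _ ≤ |a * ‖z‖ ^ 4| + |2 * b * (z ^ 3 * conj z).re| + |2 * c * (z ^ 3 * conj z).im| :=
        (abs_sub _ _).trans (add_le_add_left (abs_add_le _ _) _)
      _ = |a| * ‖z‖ ^ 4 + 2 * |b| * |(z ^ 3 * conj z).re| + 2 * |c| * |(z ^ 3 * conj z).im| := by
        simp [abs_mul]
      _ ≤ |a| * ‖z‖ ^ 4 + 2 * |b| * ‖z‖ ^ 4 + 2 * |c| * ‖z‖ ^ 4 := by gcongr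
      _ = _ := by ring
  -- Differentiating the last component of `e ∘ e.symm = id` in the last direction gives `1`,
  -- whereas the critical point gives `0`.
  have hid : HasFDerivAt (fun x => e (e.symm x)) (ContinuousLinearMap.id ℂ C4) 0 := by
    refine (hasFDerivAt_id (0 : C4)).congr_of_eventuallyEq ?_
    filter_upwards [e.open_target.mem_nhds h0'] with x hx
    exact e.right_inv hx
  have hcomp : HasFDerivAt (fun x => e (e.symm x) 3) (0 : C4 →L[ℂ] ℂ) 0 := by
    have h1 : HasFDerivAt (fun x => e x 3) (0 : C4 →L[ℂ] ℂ) (e.symm 0) := by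
      rw [hs0, ← hcrit]
      exact (hφ.differentiableAt (e.open_source.mem_nhds h0)).hasFDerivAt
    exact (h1.comp (0 : C4) hd').congr_fderiv (ContinuousLinearMap.zero_comp _)
  have := congrArg (fun L : C4 →L[ℂ] ℂ => L (Pi.single 3 1))
    (hcomp.unique (hasFDerivAt_pi'.1 hid 3))
  simp at this

end Rigidity

/-! ### Recentring the model surface and the condition on the parameters -/

section Triangular

/-- The lower triangular homeomorphism of `ℂ⁴` whose nonlinear part depends on the first
coordinate only. -/
noncomputable def triangularHomeomorph (d : Fin 4 → ℂ) (hd : ∀ i, d i ≠ 0) (z₀ k r l : ℂ)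
    (P Q R : ℂ → ℂ) (hP : Continuous P) (hQ : Continuous Q) (hR : Continuous R) : C4 ≃ₜ C4 where
  toFun p := ![d 0 * p 0 + z₀, d 1 * p 1 + P (p 0), d 2 * p 2 + k * p 1 + Q (p 0),
    d 3 * p 3 + r * p 2 + l * p 1 + R (p 0)]
  invFun q :=
    let x₀ := (q 0 - z₀) / d 0
    let x₁ := (q 1 - P x₀) / d 1
    let x₂ := (q 2 - k * x₁ - Q x₀) / d 2
    ![x₀, x₁, x₂, (q 3 - r * x₂ - l * x₁ - R x₀) / d 3]
  left_inv p := by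
    have h0 := hd 0
    have h1 := hd 1
    have h2 := hd 2
    have h3 := hd 3
    ext i
    fin_cases i <;> simp [h0, h1] <;> field_simp <;> ring
  right_inv q := by
    have h0 := hd 0
    have h1 := hd 1
    have h2 := hd 2
    have h3 := hd 3
    ext i
    fin_cases i <;> simp [mul_div_cancel₀, h0, h1, h2, h3] <;> ring
  continuous_toFun := by
    refine continuous_pi fun i => ?_
    fin_cases i <;> simp <;> fun_prop
  continuous_invFun := by
    refine continuous_pi fun i => ?_
    fin_cases i <;> simp <;> fun_prop

variable (d : Fin 4 → ℂ) (hd : ∀ i, d i ≠ 0) (z₀ k r l : ℂ) {P Q R : ℂ → ℂ}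
  (hP : Differentiable ℂ P) (hQ : Differentiable ℂ Q) (hR : Differentiable ℂ R)

theorem differentiable_triangularHomeomorph : Differentiable ℂ
    (triangularHomeomorph d hd z₀ k r l P Q R hP.continuous hQ.continuous hR.continuous) := by
  refine differentiable_pi.2 fun i => ?_
  fin_cases i <;> simp [triangularHomeomorph] <;> fun_prop

theorem differentiable_triangularHomeomorph_symm : Differentiable ℂ
    (triangularHomeomorph d hd z₀ k r l P Q R hP.continuous hQ.continuous
      hR.continuous).symm := by
  refine differentiable_pi.2 fun i => ?_
  fin_cases i <;> simp [triangularHomeomorph, Homeomorph.symm] <;> fun_prop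

theorem isBiholomorphism_of_homeomorph {e : C4 ≃ₜ C4} (h : Differentiable ℂ e)
    (h' : Differentiable ℂ e.symm) : IsBiholomorphism e.toOpenPartialHomeomorph :=
  ⟨h.differentiableOn, h'.differentiableOn⟩

/-- Recentring `Q_{a,b,c}` at its point over `x + i y` with vanishing real parts of `w₂, w₃, w₄` by
a triangular biholomorphism of `ℂ⁴` brings it into the form `perturbedSurface s a b c`, with `s` a
linear form in `(x, y)`. -/
theorem exists_homeomorph_perturbedSurface (a b c x y : ℝ) :
    ∃ e : C4 ≃ₜ C4, Differentiable ℂ e ∧ Differentiable ℂ e.symm ∧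
      ∀ p ∈ perturbedSurface (3 * c * x + (3 * b - 2 * a) * y) a b c, e p ∈ modelSurface a b c := by
  set z : ℂ := ⟨x, y⟩
  set β : ℂ := ⟨b, c⟩
  -- With `β = b + ic` the non-`a` part of the last equation is `2 Re(β z³ z̄)`. After substituting
  -- `z + ζ`, pluriharmonic terms in `ζ` go into the three functions of `ζ`, multiples of `|ζ|²` are
  -- absorbed by `w₂` and those of `|ζ|² Re ζ` by `w₃`. Only the multiple of `|ζ|² Im ζ` in the last
  -- equation survives.
  refine ⟨triangularHomeomorph (fun _ => 1) (fun _ => one_ne_zero) z (4 * x : ℝ)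
    (2 * a * x + 3 * (b * x - c * y) : ℝ)
    (4 * a * (x ^ 2 + y ^ 2) + 6 * (β * z ^ 2).re : ℝ)
    (fun ζ => Complex.I * (2 * conj z * ζ + z * conj z))
    (fun ζ => Complex.I * (2 * (2 * (z * conj z) * ζ + conj z * ζ ^ 2 + conj z ^ 2 * ζ
      + z ^ 2 * conj z)))
    (fun ζ => Complex.I * (a * ((z * conj z) ^ 2 + 4 * conj z ^ 2 * z * ζ + 2 * conj z ^ 2 * ζ ^ 2)
      + 2 * (β * z ^ 3 * conj z + 3 * β * z ^ 2 * conj z * ζ + 3 * β * z * conj z * ζ ^ 2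
        + β * conj z * ζ ^ 3 + conj β * conj z ^ 3 * ζ)))
    (Differentiable.continuous (𝕜 := ℂ) (by fun_prop))
    (Differentiable.continuous (𝕜 := ℂ) (by fun_prop))
    (Differentiable.continuous (𝕜 := ℂ) (by fun_prop)),
    differentiable_triangularHomeomorph _ _ _ _ _ _ (by fun_prop) (by fun_prop) (by fun_prop),
    differentiable_triangularHomeomorph_symm _ _ _ _ _ _ (by fun_prop) (by fun_prop)
      (by fun_prop), ?_⟩
  rintro p ⟨h1, h2, h3⟩
  simp only [Complex.norm_pow_two, Complex.norm_pow_four] at h1 h2 h3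
  simp only [modelSurface, Set.mem_ofPred_eq, Complex.norm_pow_two, Complex.norm_pow_four]
  simp [pow_succ] at h1 h2 h3
  refine ⟨?_, ?_, ?_⟩
  · simp [triangularHomeomorph, pow_succ, z, h1]
    ring
  · simp [triangularHomeomorph, pow_succ, z, h1, h2]
    ring
  · simp [triangularHomeomorph, pow_succ, z, β, h1, h2, h3]
    ring

theorem parameters_of_isLocallyHolHomogeneous {a b c : ℝ} (habc : (a, b, c) ≠ (0, 0, 0))
    (h : IsLocallyHolHomogeneous (modelSurface a b c)) :
    ∃ t : ℝ, t ≠ 0 ∧ (a, b, c) = t • ((3 : ℝ), (2 : ℝ), (0 : ℝ)) := by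
  -- Homogeneity is used only between the recentred point and the origin.
  have key : ∀ x y : ℝ, 3 * c * x + (3 * b - 2 * a) * y = 0 := by
    intro x y
    by_contra hs
    obtain ⟨ψ, hψ, hψ', hmap⟩ := exists_homeomorph_perturbedSurface a b c x y
    have h0 : (0 : C4) ∈ modelSurface a b c := by simp [modelSurface]
    have h0' : (0 : C4) ∈ perturbedSurface (3 * c * x + (3 * b - 2 * a) * y) a b c := by
      simp [perturbedSurface]
    obtain ⟨e, he, hsrc, him, he0⟩ := h _ (hmap 0 h0') 0 h0
    refine not_exists_biholomorphism_of_perturbedSurface (a := a) (b := b) (c := c) hs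
      (e := ψ.toOpenPartialHomeomorph.trans e) ⟨?_, ?_⟩ ?_ ?_ ?_
    · exact he.1.comp hψ.differentiableOn fun p hp => by simpa using hp
    · exact (hψ'.differentiableOn (s := Set.univ)).comp (he.2.mono fun p hp => by simpa using hp)
        fun p _ => Set.mem_univ _
    · simpa using hsrc
    · simpa using he0
    · intro p hp hpS
      have hp' : ψ p ∈ e.source := by simpa using hp
      exact (him.subset (Set.mem_image_of_mem e ⟨hp', hmap p hpS⟩)).2
  have hc : c = 0 := by linarith [key 1 0]
  have hb : b = 2 * (a / 3) := by linarith [key 0 1]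
  refine ⟨a / 3, fun h => habc ?_, ?_⟩
  · have ha : a = 0 := by linarith
    simp [hb, hc, ha]
  · simp only [Prod.smul_mk, smul_eq_mul, Prod.mk.injEq]
    exact ⟨by ring, by linarith, by linarith⟩

end Triangular

/-! ### The surface `Q_{3t,2t,0}` as a tube, and its transitive automorphisms -/

section Sufficiency

theorem exists_homeomorph_triangularMap {t : ℝ} (ht : t ≠ 0) :
    ∃ e : C4 ≃ₜ C4, (∀ p : C4, e p = triangularMap t p) ∧
      Differentiable ℂ e ∧ Differentiable ℂ e.symm := by
  have htC : (t : ℂ) ≠ 0 := Complex.ofReal_ne_zero.2 ht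
  have hd : ∀ i, (![2, -2 * Complex.I, -3 * Complex.I, -(2 * Complex.I / (t : ℂ))] :
      Fin 4 → ℂ) i ≠ 0 := by
    intro i
    fin_cases i <;> simp [htC]
  refine ⟨triangularHomeomorph _ hd 0 0 0 0 (fun z => 2 * z ^ 2) (fun z => 2 * z ^ 3)
    (fun z => 2 * z ^ 4) (by fun_prop) (by fun_prop) (by fun_prop), fun p => ?_,
    differentiable_triangularHomeomorph _ _ _ _ _ _ (by fun_prop) (by fun_prop) (by fun_prop),
    differentiable_triangularHomeomorph_symm _ _ _ _ _ _ (by fun_prop) (by fun_prop)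
      (by fun_prop)⟩
  simp [triangularHomeomorph, triangularMap]

/-- With `x₁ = z + z̄`, the binomial expansions are `x₁² = 2 Re z² + 2|z|²`, `x₁³ = 2 Re z³ + 6
Re(z² z̄)` and `x₁⁴ = 2 Re z⁴ + 8 Re(z³ z̄) + 6|z|⁴`. The terms `2 Re zⁿ` are the polynomial parts
of the map; the others are multiples of `Im wₙ`. -/
theorem triangularMap_mem_tubeC_iff {t : ℝ} (ht : t ≠ 0) (p : C4) :
    triangularMap t p ∈ tubeC ↔ p ∈ modelSurface (3 * t) (2 * t) 0 := by
  have hdiv : (2 * Complex.I / (t : ℂ)) = ((2 / t : ℝ) : ℂ) * Complex.I := by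
    push_cast
    ring
  simp only [tubeC, tube, momentCurve, modelSurface, Set.mem_ofPred_eq, triangularMap, hdiv,
    Complex.norm_pow_two, Complex.norm_pow_four]
  simp [pow_succ]
  refine and_congr ?_ (and_congr ?_ ?_)
  · constructor <;> intro h <;> linarith
  · constructor <;> intro h <;> linarith
  · field_simp
    constructor <;> intro h <;> linarith

theorem image_modelSurface_of_eq_triangularMap {t : ℝ} (ht : t ≠ 0) {e : C4 ≃ₜ C4}
    (he : ∀ p : C4, e p = triangularMap t p) : e '' modelSurface (3 * t) (2 * t) 0 = tubeC := by
  ext q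
  rw [e.image_eq_preimage_symm, Set.mem_preimage, ← triangularMap_mem_tubeC_iff ht, ← he,
    e.apply_symm_apply]

theorem areBiholomorphic_tubeC {t : ℝ} (ht : t ≠ 0) :
    AreBiholomorphic (modelSurface (3 * t) (2 * t) 0) tubeC := by
  obtain ⟨e, he, hd, hd'⟩ := exists_homeomorph_triangularMap ht
  exact ⟨e.toOpenPartialHomeomorph, isBiholomorphism_of_homeomorph hd hd', by simp, by simp,
    image_modelSurface_of_eq_triangularMap ht he⟩

/-- The affine shift of the curve parameter by `h`, extended to `ℂ⁴`, matches the real parts; a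
translation by `i v` preserves the tube and matches the imaginary parts. -/
theorem exists_homeomorph_tubeC {p q : C4} (hp : p ∈ tubeC) (hq : q ∈ tubeC) :
    ∃ e : C4 ≃ₜ C4, Differentiable ℂ e ∧ Differentiable ℂ e.symm ∧
      (∀ x, e x ∈ tubeC ↔ x ∈ tubeC) ∧ e p = q := by
  obtain ⟨h, hh⟩ : ∃ h : ℝ, (q 0).re = (p 0).re + h := ⟨_, (add_sub_cancel _ _).symm⟩
  -- The subtracted vector is the linear part of the shift applied to `p`; the constant part of the
  -- shift is real.
  obtain ⟨v, hv⟩ : ∃ v : Fin 4 → ℝ, ∀ i, v i = (q i).im - (![p 0, p 1 + 2 * h * p 0,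
    p 2 + 3 * h * p 1 + 3 * h ^ 2 * p 0,
    p 3 + 4 * h * p 2 + 6 * h ^ 2 * p 1 + 4 * h ^ 3 * p 0] i : ℂ).im := ⟨_, fun _ => rfl⟩
  have v0 := hv 0
  have v1 := hv 1
  have v2 := hv 2
  have v3 := hv 3
  refine ⟨triangularHomeomorph (fun _ => 1) (fun _ => one_ne_zero) (h + v 0 * Complex.I)
    (3 * h) (4 * h) (6 * h ^ 2) (fun z => 2 * h * z + (h ^ 2 + v 1 * Complex.I))
    (fun z => 3 * h ^ 2 * z + (h ^ 3 + v 2 * Complex.I))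
    (fun z => 4 * h ^ 3 * z + (h ^ 4 + v 3 * Complex.I))
    (by fun_prop) (by fun_prop) (by fun_prop),
    differentiable_triangularHomeomorph _ _ _ _ _ _ (by fun_prop) (by fun_prop) (by fun_prop),
    differentiable_triangularHomeomorph_symm _ _ _ _ _ _ (by fun_prop) (by fun_prop)
      (by fun_prop), fun x => ?_, ?_⟩
  · simp only [tubeC, tube, momentCurve, Set.mem_ofPred_eq, triangularHomeomorph]
    simp [← Complex.ofReal_pow]
    constructor
    · rintro ⟨h1, h2, h3⟩
      have e1 : (x 1).re = (x 0).re ^ 2 := by linear_combination h1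
      have e2 : (x 2).re = (x 0).re ^ 3 := by linear_combination h2 - 3 * h * e1
      exact ⟨e1, e2, by linear_combination h3 - 4 * h * e2 - 6 * h ^ 2 * e1⟩
    · rintro ⟨h1, h2, h3⟩
      exact ⟨by linear_combination h1, by linear_combination h2 + 3 * h * h1,
        by linear_combination h3 + 4 * h * h2 + 6 * h ^ 2 * h1⟩
  · simp only [tubeC, tube, momentCurve, Set.mem_ofPred_eq] at hp hq
    obtain ⟨p1, p2, p3⟩ := hp
    obtain ⟨q1, q2, q3⟩ := hq
    simp [← Complex.ofReal_pow] at v0 v1 v2 v3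
    ext i
    fin_cases i
    · refine Complex.ext ?_ ?_
      · simp [triangularHomeomorph, hh]
      · simp [triangularHomeomorph, v0]
    · refine Complex.ext ?_ ?_
      · simp [triangularHomeomorph, ← Complex.ofReal_pow, p1, q1, hh]
        ring
      · simp [triangularHomeomorph, ← Complex.ofReal_pow, v1]
        ring
    · refine Complex.ext ?_ ?_
      · simp [triangularHomeomorph, ← Complex.ofReal_pow, p1, p2, q2, hh]
        ring
      · simp [triangularHomeomorph, ← Complex.ofReal_pow, v2]
        ring
    · refine Complex.ext ?_ ?_
      · simp [triangularHomeomorph, ← Complex.ofReal_pow, p1, p2, p3, q3, hh]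
        ring
      · simp [triangularHomeomorph, ← Complex.ofReal_pow, v3]
        ring

theorem isHolHomogeneous_modelSurface {t : ℝ} (ht : t ≠ 0) :
    IsHolHomogeneous (modelSurface (3 * t) (2 * t) 0) := by
  intro p hp q hq
  obtain ⟨e, he, hd, hd'⟩ := exists_homeomorph_triangularMap ht
  have hmem : ∀ x, e x ∈ tubeC ↔ x ∈ modelSurface (3 * t) (2 * t) 0 := fun x => by
    rw [he, triangularMap_mem_tubeC_iff ht]
  obtain ⟨g, hg, hg', hgC, hgp⟩ := exists_homeomorph_tubeC ((hmem p).2 hp) ((hmem q).2 hq)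
  refine ⟨((e.trans g).trans e.symm).toOpenPartialHomeomorph,
    isBiholomorphism_of_homeomorph (hd'.comp (hg.comp hd)) (hd'.comp (hg'.comp hd)),
    by simp, by simp, ?_, by simp [hgp]⟩
  change ((e.trans g).trans e.symm) '' _ = _
  ext x
  rw [Homeomorph.image_eq_preimage_symm, Set.mem_preimage, ← hmem, ← hmem, ← hgC]
  simp

end Sufficiency

/-! ### Affine homogeneity of the moment curve -/

section MomentCurve

/-- The linear part of the affine map of `ℝ⁴` that shifts the parameter of the moment curve
by `h`. -/
noncomputable def momentShiftLinear (h : ℝ) : (Fin 4 → ℝ) →ₗ[ℝ] (Fin 4 → ℝ) where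
  toFun x := ![x 0, x 1 + 2 * h * x 0, x 2 + 3 * h * x 1 + 3 * h ^ 2 * x 0,
    x 3 + 4 * h * x 2 + 6 * h ^ 2 * x 1 + 4 * h ^ 3 * x 0]
  map_add' x y := by
    ext i
    fin_cases i <;> simp <;> ring
  map_smul' k x := by
    ext i
    fin_cases i <;> simp <;> ring

theorem momentShiftLinear_neg_comp (h : ℝ) :
    (momentShiftLinear (-h)).comp (momentShiftLinear h) = LinearMap.id := by
  refine LinearMap.ext fun x => ?_
  ext i
  fin_cases i <;> simp [momentShiftLinear] <;> ring

/-- The affine automorphism of `ℝ⁴` that shifts the parameter of the moment curve by `h`. -/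
noncomputable def momentShift (h : ℝ) : (Fin 4 → ℝ) ≃ᵃ[ℝ] (Fin 4 → ℝ) :=
  (LinearEquiv.ofLinearMap (momentShiftLinear h) (momentShiftLinear (-h))
    (by simpa using momentShiftLinear_neg_comp (-h))
    (momentShiftLinear_neg_comp h)).toAffineEquiv.trans
    (AffineEquiv.constVAdd ℝ (Fin 4 → ℝ) ![h, h ^ 2, h ^ 3, h ^ 4])

/-- By the binomial theorem `(s + h)ⁿ` is affine in `s, …, sⁿ`, with constant term `hⁿ`. -/
theorem momentShift_apply (h s : ℝ) :
    momentShift h ![s, s ^ 2, s ^ 3, s ^ 4] =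
      ![s + h, (s + h) ^ 2, (s + h) ^ 3, (s + h) ^ 4] := by
  ext i
  fin_cases i <;> simp [momentShift, momentShiftLinear] <;> ring

theorem eq_of_mem_momentCurve {x : Fin 4 → ℝ} (hx : x ∈ momentCurve) :
    x = ![x 0, x 0 ^ 2, x 0 ^ 3, x 0 ^ 4] := by
  obtain ⟨h1, h2, h3⟩ := hx
  ext i
  fin_cases i <;> simp [h1, h2, h3]

theorem isAffinelyHomogeneous_momentCurve : IsAffinelyHomogeneous momentCurve := by
  intro x hx y hy
  refine ⟨momentShift (y 0 - x 0), Set.Subset.antisymm ?_ ?_, ?_⟩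
  · rintro _ ⟨u, hu, rfl⟩
    rw [eq_of_mem_momentCurve hu, momentShift_apply]
    exact ⟨rfl, rfl, rfl⟩
  · intro u hu
    set s := u 0 - (y 0 - x 0) with hs
    refine ⟨![s, s ^ 2, s ^ 3, s ^ 4], ⟨rfl, rfl, rfl⟩, ?_⟩
    rw [momentShift_apply, hs, sub_add_cancel]
    exact (eq_of_mem_momentCurve hu).symm
  · rw [eq_of_mem_momentCurve hx, momentShift_apply]
    conv_rhs => rw [eq_of_mem_momentCurve hy]
    simp

end MomentCurve

end

theorem proposition2 :
    -- every holomorphically homogeneous model surface has `(a : b : c) = (3 : 2 : 0)`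
    -- and is biholomorphic to `𝒞`; conversely `(a : b : c) = (3 : 2 : 0)` gives homogeneity
    (∀ a b c : ℝ, (a, b, c) ≠ (0, 0, 0) →
      (IsLocallyHolHomogeneous (modelSurface a b c) →
        (∃ t : ℝ, t ≠ 0 ∧ (a, b, c) = t • ((3 : ℝ), (2 : ℝ), (0 : ℝ))) ∧
        AreBiholomorphic (modelSurface a b c) tubeC) ∧
      ((∃ t : ℝ, t ≠ 0 ∧ (a, b, c) = t • ((3 : ℝ), (2 : ℝ), (0 : ℝ))) →
        IsHolHomogeneous (modelSurface a b c))) ∧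
    -- the explicit biholomorphic map of `ℂ⁴` onto itself that takes the surface onto `𝒞`
    (∀ t : ℝ, t ≠ 0 →
      ∃ e : C4 ≃ₜ C4,
        (∀ p : C4, e p = triangularMap t p) ∧
        Differentiable ℂ e ∧ Differentiable ℂ e.symm ∧
        e '' modelSurface (3 * t) (2 * t) 0 = tubeC) ∧
    -- `𝒞` is the tube over an affinely homogeneous curve
    IsAffinelyHomogeneous momentCurve := by
  refine ⟨fun a b c habc => ⟨fun h => ?_, ?_⟩, fun t ht => ?_, isAffinelyHomogeneous_momentCurve⟩
  · obtain ⟨t, ht, h'⟩ := parameters_of_isLocallyHolHomogeneous habc h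
    refine ⟨⟨t, ht, h'⟩, ?_⟩
    simp only [Prod.smul_mk, smul_eq_mul, Prod.mk.injEq, mul_zero] at h'
    rw [h'.1, h'.2.1, h'.2.2, mul_comm t 3, mul_comm t 2]
    exact areBiholomorphic_tubeC ht
  · rintro ⟨t, ht, h'⟩
    simp only [Prod.smul_mk, smul_eq_mul, Prod.mk.injEq, mul_zero] at h'
    rw [h'.1, h'.2.1, h'.2.2, mul_comm t 3, mul_comm t 2]
    exact isHolHomogeneous_modelSurface ht
  · obtain ⟨e, he, hd, hd'⟩ := exists_homeomorph_triangularMap ht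
    exact ⟨e, he, hd, hd', image_modelSurface_of_eq_triangularMap ht he⟩
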